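/- Let $\mathbb F$ be a field, $d\ge 0$ an integer, and $V$ a vector space over $\mathbb F$ of dimension $d+1$. An element of $\mathrm{End}(V)$ is multiplicity-free if it has $d+1$ mutually distinct eigenvalues in $\mathbb F$; its primitive idempotents are the projections onto its eigenspaces along the sum of the others. A Leonard system on $V$ is a sequence $(A;\{E_i\}_{i=0}^d;A^*;\{E_i^*\}_{i=0}^d)$ in which $A,A^*\in\mathrm{End}(V)$ are multiplicity-free, $\{E_i\}_{i=0}^d$ and $\{E_i^*\}_{i=0}^d$ are orderings of the primitive idempotents of $A$ and of $A^*$ respectively, and, for $0\le i,j\le d$, each of $E_i^*AE_j^*$ and $E_iA^*E_j$ is zero if $|i-j|>1$ and nonzero if $|i-j|=1$. It is bipartite if $\mathrm{tr}(E_i^*A)=0$ for $0\le i\le d$. Let $\theta_i$ (resp. $\theta_i^*$) be the eigenvalue of $A$ (resp. $A^*$) associated with the eigenspace $E_iV$ (resp. $E_i^*V$). For every bipartite Leonard system $(A;\{E_i\}_{i=0}^d;A^*;\{E_i^*\}_{i=0}^d)$ on $V$: (i) $$\theta_i(\theta^*_{d-i-1}-\theta^*_{i+1})=\theta_{i+1}(\theta^*_{d-i}-\theta^*_i)\qquad(0\le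 i\le d-1).$$ (ii) Consequently the eigenvalues $\theta_i$ can be computed recursively from the $\theta_i^*$ and one nonzero $\theta_j$. Precisely, let $0\le j\le d$ with $\theta_j\ne 0$. Start from the value $\theta_j$ at the index $j$ and apply the following steps repeatedly, in any order: from a value $y$ at $i$ $(0\le i\le d)$ obtain the value $-y$ at $d-i$; for $0\le i\le d-1$, from a value $y$ at $i$ obtain the value $y\,\dfrac{\theta^*_{d-i-1}-\theta^*_{i+1}}{\theta^*_{d-i}-\theta^*_i}$ at $i+1$, provided $\theta^*_{d-i}\neq\theta^*_i$; and for $0\le i\le d-1$, from a value $y$ at $i+1$ obtain the value $y\,\dfrac{\theta^*_{d-i}-\theta^*_i}{\theta^*_{d-i-1}-\theta^*_{i+1}}$ at $i$, provided $\theta^*_{d-i-1}\ne\theta^*_{i+1}$. Then for every $0\le i\le d$ some finite sequence of steps yields a value at $i$, and every value so obtained at $i$ equals $\theta_i$. -/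

import Mathlib

namespace Leonard

variable {F V : Type*} [Field F] [AddCommGroup V] [Module F V]

/-- `A` has `d + 1` mutually distinct eigenvalues in `F` (used for `dim V = d + 1`). -/
def MultiplicityFree (d : ℕ) (A : Module.End F V) : Prop :=
  ∃ θ : Fin (d + 1) → F, Function.Injective θ ∧ ∀ i, A.HasEigenvalue (θ i)

/-- `E₀, …, E_d` is an ordering of the primitive idempotents of `A`: for some ordering
`θ₀, …, θ_d` of the (distinct) eigenvalues of `A`, the map `E i` is the identity on the
eigenspace of `θ i` and vanishes on the eigenspaces of the other `θ j`. -/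
def IsPrimitiveIdempotents {d : ℕ} (A : Module.End F V) (E : Fin (d + 1) → Module.End F V) :
    Prop :=
  ∃ θ : Fin (d + 1) → F, Function.Injective θ ∧ (∀ i, A.HasEigenvalue (θ i)) ∧
    (∀ i, ∀ v ∈ A.eigenspace (θ i), E i v = v) ∧
    (∀ i j, i ≠ j → ∀ v ∈ A.eigenspace (θ j), E i v = 0)

/-- `E i * B * E j` is zero if `|i - j| > 1` and nonzero if `|i - j| = 1`. -/
def ActsIrredTridiagonally {d : ℕ} (E : Fin (d + 1) → Module.End F V) (B : Module.End F V) :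
    Prop :=
  (∀ i j : Fin (d + 1), 1 < |(i : ℤ) - (j : ℤ)| → E i * B * E j = 0) ∧
  (∀ i j : Fin (d + 1), |(i : ℤ) - (j : ℤ)| = 1 → E i * B * E j ≠ 0)

/-- `(A; E; A*; E*)` is a Leonard system on the `(d + 1)`-dimensional space `V`. -/
structure IsLeonardSystem {d : ℕ} (A : Module.End F V) (E : Fin (d + 1) → Module.End F V)
    (As : Module.End F V) (Es : Fin (d + 1) → Module.End F V) : Prop where
  finrank_eq : Module.finrank F V = d + 1
  multiplicityFree : MultiplicityFree d A
  multiplicityFree_star : MultiplicityFree d As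
  idempotents : IsPrimitiveIdempotents A E
  idempotents_star : IsPrimitiveIdempotents As Es
  tridiagonal : ActsIrredTridiagonally Es A
  tridiagonal_star : ActsIrredTridiagonally E As

/-- All the intersection numbers `a i = tr (E*_i A)` vanish. -/
def IsBipartite {d : ℕ} (A : Module.End F V) (Es : Fin (d + 1) → Module.End F V) : Prop :=
  ∀ i, LinearMap.trace F V (Es i * A) = 0

/-- The subspace `W` is an eigenspace of `A`, and `t` is the eigenvalue associated with it. -/
def IsEigenvalueOf (A : Module.End F V) (W : Submodule F V) (t : F) : Prop :=
  W ≠ ⊥ ∧ W = A.eigenspace t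

/-- `RecComputes θs j x i y`: starting from the value `x` at the index `j`, the value `y` at the
index `i` is obtained in finitely many steps, each of which uses only the scalars `θs`: a step
either passes from `i` to `d - i` by a change of sign, or solves the relation
`θ i * (θs (d-i-1) - θs (i+1)) = θ (i+1) * (θs (d-i) - θs i)` for one of `θ (i+1)`, `θ i`,
given the other one, when its coefficient is nonzero. Here `Fin.rev i` is the index `d - i`. -/
inductive RecComputes {d : ℕ} (θs : Fin (d + 1) → F) (j : Fin (d + 1)) (x : F) :
    Fin (d + 1) → F → Prop
  | start : RecComputes θs j x j x
  | reflect (i : Fin (d + 1)) (y : F) : RecComputes θs j x i y → RecComputes θs j x i.rev (-y)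
  | up (i : Fin d) (y : F) : RecComputes θs j x i.castSucc y →
      θs i.castSucc.rev - θs i.castSucc ≠ 0 →
      RecComputes θs j x i.succ
        (y * (θs i.succ.rev - θs i.succ) / (θs i.castSucc.rev - θs i.castSucc))
  | down (i : Fin d) (y : F) : RecComputes θs j x i.succ y →
      θs i.succ.rev - θs i.succ ≠ 0 →
      RecComputes θs j x i.castSucc
        (y * (θs i.castSucc.rev - θs i.castSucc) / (θs i.succ.rev - θs i.succ))

end Leonard

namespace Leonard

open Module

/-! ### Coordinates under triangular change of basis, and a trace formula. -/

section Triangular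

variable {F V ι α : Type*} [Field F] [AddCommGroup V] [Module F V] [Fintype ι]

/-! Everything follows from θ*_{d-i} - θ*_i = c θ_i with one constant c ≠ 0 (`exists_proportional`,
for d > 0).

In the split basis A is lower bidiagonal and A* upper bidiagonal, with diagonals θ and θ*. Computing
tr(PA) and tr(QA*) there, for the partial sums P, Q of the E*_h and E_h over h ≤ i, expresses one
entry φ ≠ 0 in two ways (`exists_split_entry`). Reversing the order of the E*_h changes neither θ
nor tr(E_h A*). With tr(E*_h A) = 0, comparing the two systems eliminates these dual traces and
leaves a relation between partial sums of θ_h and of θ*_{d-h} - θ*_h, which induction on i turns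
into proportionality.

Then (i) is immediate and θ_{d-i} = -θ_i. As the θ_i are distinct, the recursion's coefficients
vanish at most at 2i = d, so every index can be reached. -/

theorem repr_apply_eq_sum (b c : Basis ι F V) (f : V →ₗ[F] V) (x : V) (i : ι) :
    b.repr (f x) i = ∑ j, c.repr x j * b.repr (f (c j)) i := by
  conv_lhs => rw [← c.sum_repr x, map_sum, map_sum, Finsupp.finsetSum_apply]
  exact Finset.sum_congr rfl fun j _ => by
    rw [map_smul, map_smul, Finsupp.smul_apply, smul_eq_mul]

/-- The change of basis never raises the grade `f`. Taking `f` to be `id` or `toDual` covers both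
kinds of triangularity. -/
theorem repr_eq_zero_of_triangular [LinearOrder α] (f : ι → α) (b c : Basis ι F V)
    (h : ∀ i j, f j < f i → b.repr (c j) i = 0) {S : Set α} (hS : IsUpperSet S) {x : V}
    (hx : ∀ i, f i ∈ S → c.repr x i = 0) (i : ι) (hi : f i ∈ S) : b.repr x i = 0 := by
  have := repr_apply_eq_sum b c LinearMap.id x i
  simp only [LinearMap.id_apply] at this
  rw [this]
  refine Finset.sum_eq_zero fun j _ => ?_
  by_cases hj : f j ∈ S
  · rw [hx j hj, zero_mul]
  · rw [h i j (lt_of_not_ge fun hle => hj (hS hle hi)), mul_zero]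

theorem triangular_symm [LinearOrder α] (f : ι → α) (b c : Basis ι F V)
    (h : ∀ i j, f j < f i → b.repr (c j) i = 0) (i j : ι) (hij : f j < f i) :
    c.repr (b j) i = 0 := by
  classical
  have hM : (b.toMatrix c).BlockTriangular f := fun i j hij => h i j hij
  let _ := b.invertibleToMatrix c
  have hinv : (b.toMatrix c)⁻¹ = c.toMatrix b :=
    Matrix.inv_eq_right_inv (b.toMatrix_mul_toMatrix_flip c)
  have := Matrix.blockTriangular_inv_of_blockTriangular hM
  rw [hinv] at this
  exact this hij

end Triangular

/-- If `P` is a projection onto the span of the first coordinate vectors, up to index `i`,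
commuting with an upper bidiagonal `Y`, then `tr (P X)` is known for each lower bidiagonal `X`. -/
theorem trace_mul_bidiagonal {F : Type*} [Field F] {d : ℕ}
    (P X Y : Matrix (Fin (d + 1)) (Fin (d + 1)) F) (i : Fin d)
    (hP1 : ∀ a b, b ≤ i.castSucc → P a b = if a = b then 1 else 0)
    (hP0 : ∀ a b, i.castSucc < a → P a b = 0)
    (hX : ∀ a b, a ≠ b → a.val ≠ b.val + 1 → X a b = 0)
    (hY : ∀ a b, a ≠ b → b.val ≠ a.val + 1 → Y a b = 0)
    (hc : P * Y = Y * P) :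
    ((P * X).trace - ∑ h ∈ Finset.Iic i.castSucc, X h h) *
      (Y i.castSucc i.castSucc - Y i.succ i.succ) = X i.succ i.castSucc * Y i.castSucc i.succ := by
  have hne : i.castSucc ≠ i.succ := Fin.castSucc_lt_succ.ne
  -- Beyond the diagonal of the identity block of `P`, only its corner entry (i, i+1) meets a
  -- nonzero entry of `X`.
  have htr : (P * X).trace = ∑ h ∈ Finset.Iic i.castSucc, X h h +
      P i.castSucc i.succ * X i.succ i.castSucc := by
    have key : ∀ a b, P a b * X b a = (if b = a then (if a ∈ Finset.Iic i.castSucc then X a a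
        else 0) else 0) + (if b = i.succ then (if a = i.castSucc then
          P i.castSucc i.succ * X i.succ i.castSucc else 0) else 0) := by
      intro a b
      simp only [Finset.mem_Iic]
      by_cases ha : a ≤ i.castSucc
      · by_cases hb : b ≤ i.castSucc
        · have h2 : b ≠ i.succ := fun h => by
            rw [h] at hb
            exact absurd hb (not_le.2 Fin.castSucc_lt_succ)
          rw [hP1 a b hb]
          by_cases hab : a = b
          · subst hab
            simp [ha, h2]
          · simp [hab, h2, Ne.symm hab]
        · have hba : b ≠ a := fun h => hb (h ▸ ha)
          by_cases hs : b = i.succ ∧ a = i.castSucc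
          · obtain ⟨rfl, rfl⟩ := hs
            simp [hba]
          · rw [hX b a hba]
            · simp [hba]
              intro h1 h2
              exact absurd ⟨h1, h2⟩ hs
            · intro hval
              apply hs
              simp only [Fin.le_def, Fin.ext_iff, Fin.val_castSucc, Fin.val_succ] at *
              omega
      · have h2 : a ≠ i.castSucc := fun h => ha h.le
        simp [hP0 a b (lt_of_not_ge ha), ha, h2]
    simp only [Matrix.trace, Matrix.diag, Matrix.mul_apply]
    rw [Finset.sum_congr rfl fun a _ => Finset.sum_congr rfl fun b _ => key a b]
    simp only [Finset.sum_add_distrib, Finset.sum_ite_eq', Finset.mem_univ, if_true,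
      Finset.sum_ite_mem, Finset.univ_inter]
  -- Entry (i, i+1) of PY = YP relates the unknown corner entry of `P` to `Y`.
  have hcomm : Y i.castSucc i.succ + P i.castSucc i.succ * Y i.succ i.succ =
      Y i.castSucc i.castSucc * P i.castSucc i.succ := by
    have h := congrFun (congrFun hc i.castSucc) i.succ
    rw [Matrix.mul_apply, Matrix.mul_apply] at h
    have h1 : ∀ b, P i.castSucc b * Y b i.succ = (if b = i.castSucc then Y i.castSucc i.succ else 0)
        + (if b = i.succ then P i.castSucc i.succ * Y i.succ i.succ else 0) := by
      intro b
      by_cases hb : b = i.castSucc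
      · subst hb
        simp [hP1 _ _ le_rfl, hne]
      · by_cases hb' : b = i.succ
        · subst hb'
          simp [hne.symm]
        · rw [hY b i.succ hb']
          · simp [hb, hb']
          · simp only [Fin.ext_iff, Fin.val_castSucc, Fin.val_succ] at *
            omega
    have h2 : ∀ b, Y i.castSucc b * P b i.succ =
        if b = i.castSucc then Y i.castSucc i.castSucc * P i.castSucc i.succ else 0 := by
      intro b
      by_cases hb : b = i.castSucc
      · subst hb
        simp
      · by_cases hb' : b = i.succ
        · subst hb'
          simp [hP0 i.succ i.succ Fin.castSucc_lt_succ, hne.symm]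
        · rw [hY i.castSucc b (Ne.symm hb)]
          · simp [hb]
          · simp only [Fin.ext_iff, Fin.val_castSucc, Fin.val_succ] at *
            omega
    rw [Finset.sum_congr rfl fun b _ => h1 b, Finset.sum_congr rfl fun b _ => h2 b] at h
    simpa only [Finset.sum_add_distrib, Finset.sum_ite_eq', Finset.mem_univ, if_true]
      using h
  rw [htr]
  linear_combination (-X i.succ i.castSucc) * hcomm

/-! ### The split basis. -/

section Split

variable {F V : Type*} [Field F] [AddCommGroup V] [Module F V] {d : ℕ}

/-- The split basis `u i = (A - θ (i-1)) ⋯ (A - θ 0) (w 0)`. -/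
theorem exists_split_basis (A : End F V) (v w : Basis (Fin (d + 1)) F V) (θ : Fin (d + 1) → F)
    (hv : ∀ i, A (v i) = θ i • v i)
    (hw0 : ∀ i j : Fin (d + 1), j.val + 1 < i.val → w.repr (A (w j)) i = 0)
    (hw1 : ∀ i : Fin d, w.repr (A (w i.castSucc)) i.succ ≠ 0) :
    ∃ u : Basis (Fin (d + 1)) F V, (∀ a b, b < a → w.repr (u b) a = 0) ∧
      (∀ a b, a < b → v.repr (u b) a = 0) ∧
      (∀ i : Fin d, A (u i.castSucc) = θ i.castSucc • u i.castSucc + u i.succ) ∧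
      A (u (Fin.last d)) = θ (Fin.last d) • u (Fin.last d) := by
  classical
  -- Extending θ to ℕ lets `U` be defined by recursion; only indices up to d matter.
  let t : ℕ → F := fun n => θ (Fin.ofNat (d + 1) n)
  have ht : ∀ i : Fin (d + 1), t i = θ i := fun i => by simp [t]
  let U : ℕ → V := fun n => Nat.rec (w 0) (fun n x => A x - t n • x) n
  have hU : ∀ n, U (n + 1) = A (U n) - t n • U n := fun _ => rfl
  -- The factor A - θ_n kills the n-th eigencoordinate.
  have hvU : ∀ n, ∀ a : Fin (d + 1), a.val < n → v.repr (U n) a = 0 := by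
    intro n
    induction n with
    | zero => intro a ha; omega
    | succ n ih =>
      intro a ha
      have hA : v.repr (A (U n)) a = v.repr (U n) a * θ a := by
        rw [repr_apply_eq_sum v v, Finset.sum_eq_single a]
        · simp [hv]
        · intro b _ hb
          simp [hv, hb]
        · simp
      rw [hU, map_sub, Finsupp.sub_apply, hA, map_smul, Finsupp.smul_apply, smul_eq_mul]
      rcases Nat.lt_succ_iff_lt_or_eq.1 ha with h | h
      · rw [ih a h]; ring
      · rw [← h, ht]; ring
  have hwU : ∀ n, ∀ a : Fin (d + 1), n < a.val → w.repr (U n) a = 0 := by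
    intro n
    induction n with
    | zero =>
      intro a ha
      have : (0 : Fin (d + 1)) ≠ a := fun h => by simp [← h] at ha
      simp [U, this]
    | succ n ih =>
      intro a ha
      rw [hU, map_sub, Finsupp.sub_apply, map_smul, Finsupp.smul_apply, ih a (by omega),
        repr_apply_eq_sum w w, Finset.sum_eq_zero, smul_zero, sub_zero]
      intro b _
      by_cases hb : n < b.val
      · rw [ih b hb, zero_mul]
      · rw [hw0 a b (by omega), mul_zero]
  have hdiag : ∀ n (hn : n < d + 1), w.repr (U n) ⟨n, hn⟩ ≠ 0 := by
    intro n
    induction n with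
    | zero =>
      intro hn
      have : (⟨0, hn⟩ : Fin (d + 1)) = 0 := rfl
      simp [U, this]
    | succ n ih =>
      intro hn
      rw [hU, map_sub, Finsupp.sub_apply, map_smul, Finsupp.smul_apply,
        hwU n ⟨n + 1, hn⟩ (Nat.lt_succ_self n), smul_zero, sub_zero, repr_apply_eq_sum w w,
        Finset.sum_eq_single ⟨n, by omega⟩]
      · exact mul_ne_zero (ih _) (hw1 ⟨n, by omega⟩)
      · intro b _ hb
        have hb' : b.val ≠ n := fun h => hb (Fin.ext h)
        by_cases hlt : n < b.val
        · rw [hwU n b hlt, zero_mul]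
        · rw [hw0 _ b (by simp only []; omega), mul_zero]
      · simp
  have hdet : IsUnit (w.det fun i : Fin (d + 1) => U i) := by
    rw [isUnit_iff_ne_zero, Basis.det_apply, Matrix.det_of_isUpperTriangular]
    · exact Finset.prod_ne_zero_iff.2 fun i _ => hdiag i i.2
    · exact fun a b hab => hwU b a hab
  obtain ⟨hli, hsp⟩ := w.is_basis_iff_det.2 hdet
  -- After d + 1 factors no eigencoordinate survives, so `U d` is an eigenvector for θ_d.
  have hend : U (d + 1) = 0 := by
    apply v.repr.injective
    ext a
    rw [hvU (d + 1) a a.2, map_zero, Finsupp.zero_apply]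
  refine ⟨Basis.mk hli hsp.ge, ?_, ?_, ?_, ?_⟩
  · intro a b hab
    rw [Basis.mk_apply]
    exact hwU b a hab
  · intro a b hab
    rw [Basis.mk_apply]
    exact hvU b a hab
  · intro i
    have := hU i
    have h := ht i.castSucc
    rw [Fin.val_castSucc] at h
    simp only [Basis.mk_apply, Fin.val_castSucc, Fin.val_succ, this, h]
    abel
  · have := hU d
    have h := ht (Fin.last d)
    rw [Fin.val_last] at h
    rw [hend, h] at this
    simp only [Basis.mk_apply, Fin.val_last]
    exact (sub_eq_zero.1 this.symm)

end Split

/-! ### From Leonard systems to proportionality. -/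

section System

variable {F V : Type*} [Field F] [AddCommGroup V] [Module F V] {d : ℕ}

/-- The range of `E i` contains an eigenvector for the i-th eigenvalue of the ordering hidden in
`hE`, which forces that ordering to be θ. -/
theorem exists_eigenbasis {A : End F V} {E : Fin (d + 1) → End F V}
    (hd : finrank F V = d + 1) (hE : IsPrimitiveIdempotents A E) {θ : Fin (d + 1) → F}
    (hθ : ∀ i, IsEigenvalueOf A (LinearMap.range (E i)) (θ i)) :
    Function.Injective θ ∧ ∃ v : Basis (Fin (d + 1)) F V, (∀ i, A (v i) = θ i • v i) ∧
      ∀ i x, E i x = v.repr x i • v i := by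
  obtain ⟨t, ht, hev, h1, h0⟩ := hE
  choose x hx using fun i => (hev i).exists_hasEigenvector
  have hli := End.eigenvectors_linearIndependent' A t ht x hx
  let v := basisOfLinearIndependentOfCardEqFinrank hli (by simp [hd])
  have hvx : ∀ i, v i = x i := fun i => by simp [v]
  have hEv : ∀ i j, E i (v j) = if i = j then v j else 0 := by
    intro i j
    rw [hvx]
    split_ifs with hij
    · subst hij
      exact h1 i _ (hx i).1
    · exact h0 i j hij _ (hx j).1
  have hmem : ∀ i, A (v i) = θ i • v i := by
    intro i
    have : v i ∈ LinearMap.range (E i) := ⟨v i, by rw [hEv, if_pos rfl]⟩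
    rw [(hθ i).2] at this
    exact End.mem_eigenspace_iff.1 this
  have hteq : t = θ := by
    funext i
    have h := hmem i
    rw [hvx, (hx i).apply_eq_smul] at h
    exact smul_left_injective F (hx i).2 h
  refine ⟨hteq ▸ ht, v, hmem, fun i y => ?_⟩
  conv_lhs => rw [← v.sum_repr y, map_sum]
  simp [hEv]

theorem tridiagonal_repr {E : Fin (d + 1) → End F V} {B : End F V}
    (hB : ActsIrredTridiagonally E B) (v : Basis (Fin (d + 1)) F V)
    (hv : ∀ i x, E i x = v.repr x i • v i) :
    (∀ i j : Fin (d + 1), 1 < |(i : ℤ) - (j : ℤ)| → v.repr (B (v j)) i = 0) ∧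
    (∀ i j : Fin (d + 1), |(i : ℤ) - (j : ℤ)| = 1 → v.repr (B (v j)) i ≠ 0) := by
  constructor
  · intro i j hij
    have h := LinearMap.congr_fun (hB.1 i j hij) (v j)
    simpa [hv, v.ne_zero] using h
  · intro i j hij h
    refine hB.2 i j hij (LinearMap.ext fun x => ?_)
    simp [hv, h]

/-- Partial sums of the intersection numbers and of the dual intersection numbers, in terms of
the eigenvalues and of an entry `φ` of the first split sequence. -/
theorem IsLeonardSystem.exists_split_entry {A As : End F V} {E Es : Fin (d + 1) → End F V}
    (hL : IsLeonardSystem A E As Es) {θ θs : Fin (d + 1) → F}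
    (hθ : ∀ i, IsEigenvalueOf A (LinearMap.range (E i)) (θ i))
    (hθs : ∀ i, IsEigenvalueOf As (LinearMap.range (Es i)) (θs i)) (i : Fin d) :
    ∃ φ : F, φ ≠ 0 ∧
      (∑ h ∈ Finset.Iic i.castSucc, LinearMap.trace F V (Es h * A) -
        ∑ h ∈ Finset.Iic i.castSucc, θ h) * (θs i.castSucc - θs i.succ) = φ ∧
      (∑ h ∈ Finset.Iic i.castSucc, LinearMap.trace F V (E h * As) -
        ∑ h ∈ Finset.Iic i.castSucc, θs h) * (θ i.castSucc - θ i.succ) = φ := by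
  classical
  obtain ⟨-, v, hAv, hEv⟩ := exists_eigenbasis hL.finrank_eq hL.idempotents hθ
  obtain ⟨-, w, hAw, hEw⟩ := exists_eigenbasis hL.finrank_eq hL.idempotents_star hθs
  obtain ⟨hw0, hw1⟩ := tridiagonal_repr hL.tridiagonal w hEw
  obtain ⟨hv0, hv1⟩ := tridiagonal_repr hL.tridiagonal_star v hEv
  obtain ⟨u, huw, huv, hAu, hAlast⟩ := exists_split_basis A v w θ hAv
    (fun i j hij => hw0 i j (by rw [lt_abs]; omega))
    (fun i => hw1 _ _ (by simp))
  have hwu := triangular_symm id w u huw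
  have hvu := triangular_symm OrderDual.toDual v u huv
  -- passage between supports in the three bases
  have toU : ∀ (S : Set (Fin (d + 1))), IsUpperSet S → ∀ x, (∀ a ∈ S, w.repr x a = 0) →
      ∀ a ∈ S, u.repr x a = 0 := fun S hS x hx =>
    repr_eq_zero_of_triangular id u w hwu hS hx
  have toU' : ∀ (S : Set (Fin (d + 1))), IsLowerSet S → ∀ x, (∀ a ∈ S, v.repr x a = 0) →
      ∀ a ∈ S, u.repr x a = 0 := fun S hS x hx =>
    repr_eq_zero_of_triangular OrderDual.toDual u v hvu
      (S := OrderDual.ofDual ⁻¹' S) hS.toDual hx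
  have ofU' : ∀ (S : Set (Fin (d + 1))), IsLowerSet S → ∀ x, (∀ a ∈ S, u.repr x a = 0) →
      ∀ a ∈ S, v.repr x a = 0 := fun S hS x hx =>
    repr_eq_zero_of_triangular OrderDual.toDual v u huv
      (S := OrderDual.ofDual ⁻¹' S) hS.toDual hx
  have hreprAw : ∀ x a, w.repr (As x) a = w.repr x a * θs a := by
    intro x a
    rw [repr_apply_eq_sum w w, Finset.sum_eq_single a]
    · simp [hAw]
    · intro b _ hb
      simp [hAw, hb]
    · simp
  have hreprAv : ∀ x a, v.repr (A x) a = v.repr x a * θ a := by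
    intro x a
    rw [repr_apply_eq_sum v v, Finset.sum_eq_single a]
    · simp [hAv]
    · intro b _ hb
      simp [hAv, hb]
    · simp
  -- the matrix of `A` in the split basis
  have hAuu : ∀ a b, u.repr (A (u b)) a =
      if a = b then θ b else if a.val = b.val + 1 then 1 else 0 := by
    intro a b
    induction b using Fin.lastCases with
    | last =>
      rw [hAlast]
      have : a.val ≠ d + 1 := a.2.ne
      simp [Finsupp.single_apply, this, eq_comm]
    | cast b =>
      rw [hAu]
      by_cases hab : a = b.castSucc
      · subst hab
        simp [Fin.castSucc_lt_succ.ne']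
      · have : (a.val = b.val + 1) ↔ b.succ = a := by
          rw [Fin.ext_iff, Fin.val_succ, eq_comm]
        simp [Finsupp.single_apply, hab, this]
  -- the matrix of `As` in the split basis
  have hAsdiag : ∀ a b, b ≤ a → u.repr (As (u b)) a = if a = b then θs b else 0 := by
    intro a b hab
    have h := toU {c | b ≤ c} (fun x y hxy hx => le_trans hx hxy) (As (u b) - θs b • u b)
      (by
        intro c hc
        rw [map_sub, Finsupp.sub_apply, hreprAw, map_smul, Finsupp.smul_apply, smul_eq_mul]
        rcases eq_or_lt_of_le (show b ≤ c from hc) with rfl | hlt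
        · ring
        · rw [huw c b hlt]; ring) a hab
    rw [map_sub, Finsupp.sub_apply, sub_eq_zero] at h
    rw [h]
    simp [Finsupp.single_apply, eq_comm]
  -- As `u b` lies in the span of v_b, …, v_d, A* lowers the least index by at most one.
  have hAslow : ∀ a b : Fin (d + 1), a.val + 1 < b.val → u.repr (As (u b)) a = 0 := by
    intro a b hab
    refine toU' {c | c ≤ a} (fun x y hxy hx => le_trans hxy hx) _ ?_ a (le_refl a)
    intro c hc
    rw [repr_apply_eq_sum v v]
    refine Finset.sum_eq_zero fun e _ => ?_
    by_cases he : e < b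
    · rw [huv e b he, zero_mul]
    · rw [hv0 c e, mul_zero]
      have h1 : c.val ≤ a.val := hc
      have h2 : b.val ≤ e.val := not_lt.1 he
      rw [lt_abs]
      omega
  set φ := u.repr (As (u i.succ)) i.castSucc with hφ
  -- If φ = 0, then A* v_{i+1} would have no v_i component, against irreducibility.
  have hφ0 : φ ≠ 0 := by
    intro h0
    refine hv1 i.castSucc i.succ (by simp) ?_
    refine ofU' {c | c ≤ i.castSucc} (fun x y hxy hx => le_trans hxy hx) _ ?_ _ (le_refl i.castSucc)
    intro c hc
    rw [repr_apply_eq_sum u u]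
    refine Finset.sum_eq_zero fun e _ => ?_
    have h1 : c.val ≤ i.val := hc
    rcases lt_trichotomy e i.succ with he | rfl | he
    · rw [hvu e i.succ he, zero_mul]
    · rcases eq_or_ne c i.castSucc with rfl | hci
      · rw [← hφ, h0, mul_zero]
      · have : c.val ≠ i.val := fun h => hci (Fin.ext h)
        rw [hAslow c i.succ (by rw [Fin.val_succ]; omega), mul_zero]
    · have h2 : i.val + 1 < e.val := he
      rw [hAslow c e (by omega), mul_zero]
  let P : End F V := ∑ h ∈ Finset.Iic i.castSucc, Es h
  let Q : End F V := ∑ h ∈ Finset.Iic i.castSucc, E h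
  have hPr : ∀ x a, w.repr (P x) a = if a ≤ i.castSucc then w.repr x a else 0 := by
    intro x a
    simp [P, hEw, Finsupp.finsetSum_apply, Finsupp.single_apply]
  have hQr : ∀ x a, v.repr (Q x) a = if a ≤ i.castSucc then v.repr x a else 0 := by
    intro x a
    simp [Q, hEv, Finsupp.finsetSum_apply, Finsupp.single_apply]
  have hPc : P * As = As * P := by
    refine LinearMap.ext fun x => w.repr.injective (Finsupp.ext fun a => ?_)
    simp only [Module.End.mul_apply, hPr, hreprAw]
    split_ifs <;> simp
  have hQc : Q * A = A * Q := by
    refine LinearMap.ext fun x => v.repr.injective (Finsupp.ext fun a => ?_)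
    simp only [Module.End.mul_apply, hQr, hreprAv]
    split_ifs <;> simp
  have hPu : ∀ b, b ≤ i.castSucc → P (u b) = u b := by
    intro b hb
    refine w.repr.injective (Finsupp.ext fun a => ?_)
    rw [hPr]
    split_ifs with ha
    · rfl
    · rw [huw a b (lt_of_le_of_lt hb (not_le.1 ha))]
  have hPu0 : ∀ a b, i.castSucc < a → u.repr (P (u b)) a = 0 := fun a b ha =>
    toU {c | i.castSucc < c} (fun x y hxy hx => lt_of_lt_of_le hx hxy) _
      (fun c hc => by rw [hPr, if_neg (not_le.2 hc)]) a ha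
  have hQu : ∀ b, i.castSucc < b → Q (u b) = 0 := by
    intro b hb
    refine v.repr.injective (Finsupp.ext fun a => ?_)
    rw [hQr, map_zero, Finsupp.zero_apply]
    split_ifs with ha
    · exact huv a b (lt_of_le_of_lt ha hb)
    · rfl
  have hQu1 : ∀ a b, a ≤ i.castSucc → u.repr (Q (u b)) a = if b = a then 1 else 0 := by
    intro a b ha
    have h := toU' {c | c ≤ i.castSucc} (fun x y hxy hx => le_trans hxy hx) (Q (u b) - u b)
      (fun c hc => by
        rw [map_sub, Finsupp.sub_apply, hQr, if_pos (show c ≤ i.castSucc from hc), sub_self]) a ha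
    rw [map_sub, Finsupp.sub_apply, sub_eq_zero] at h
    rw [h]
    simp [Finsupp.single_apply]
  let m := LinearMap.toMatrix u u
  have hm : ∀ f a b, m f a b = u.repr (f (u b)) a := fun f a b => LinearMap.toMatrix_apply u u f a b
  have hmm : ∀ f g : End F V, m (f * g) = m f * m g := fun f g => LinearMap.toMatrix_mul u f g
  have hAmat : ∀ a b, a ≠ b → a.val ≠ b.val + 1 → m A a b = 0 := by
    intro a b h1 h2
    rw [hm, hAuu, if_neg h1, if_neg h2]
  have hAsmat : ∀ a b, a ≠ b → b.val ≠ a.val + 1 → m As a b = 0 := by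
    intro a b h1 h2
    rw [hm]
    rcases le_or_gt b a with h | h
    · rw [hAsdiag a b h, if_neg h1]
    · have : a.val < b.val := h
      exact hAslow a b (by omega)
  have hsub : m A i.succ i.castSucc = 1 := by
    rw [hm, hAuu, if_neg Fin.castSucc_lt_succ.ne', if_pos (by simp)]
  have hAd : ∀ a, m A a a = θ a := fun a => by rw [hm, hAuu, if_pos rfl]
  have hAsd : ∀ a, m As a a = θs a := fun a => by rw [hm, hAsdiag a a le_rfl, if_pos rfl]
  have hsup : m As i.castSucc i.succ = φ := hm _ _ _
  refine ⟨φ, hφ0, ?_, ?_⟩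
  · have h := trace_mul_bidiagonal (m P) (m A) (m As) i
      (fun a b hb => by
        rw [hm, hPu b hb]
        simp [Finsupp.single_apply, eq_comm])
      (fun a b ha => by rw [hm, hPu0 a b ha]) hAmat hAsmat (by rw [← hmm, ← hmm, hPc])
    rw [← hmm, ← LinearMap.trace_eq_matrix_trace F u (P * A), hsub, hsup, one_mul] at h
    simpa only [hAd, hAsd, P, Finset.sum_mul, map_sum] using h
  -- `Q` kills u_b for b > i and is the identity modulo their span: transposed, this is the shape of
  -- `P`, with A and A* exchanged.
  · have h := trace_mul_bidiagonal (m Q).transpose (m As).transpose (m A).transpose i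
      (fun a b hb => by
        rw [Matrix.transpose_apply, hm, hQu1 b a hb])
      (fun a b ha => by rw [Matrix.transpose_apply, hm, hQu a ha]; simp)
      (fun a b h1 h2 => hAsmat b a h1.symm h2)
      (fun a b h1 h2 => hAmat b a h1.symm h2)
      (by rw [← Matrix.transpose_mul, ← Matrix.transpose_mul, ← hmm, ← hmm, hQc])
    rw [← Matrix.transpose_mul, Matrix.trace_transpose, Matrix.trace_mul_comm, ← hmm,
      ← LinearMap.trace_eq_matrix_trace F u (Q * As)] at h
    simp only [Matrix.transpose_apply] at h
    rw [hsub, hsup, mul_one] at h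
    simpa only [hAd, hAsd, Q, Finset.sum_mul, map_sum] using h

theorem IsLeonardSystem.rev_star {A As : End F V} {E Es : Fin (d + 1) → End F V}
    (hL : IsLeonardSystem A E As Es) : IsLeonardSystem A E As fun i => Es i.rev where
  finrank_eq := hL.finrank_eq
  multiplicityFree := hL.multiplicityFree
  multiplicityFree_star := hL.multiplicityFree_star
  idempotents := hL.idempotents
  idempotents_star := by
    obtain ⟨t, ht, hev, h1, h0⟩ := hL.idempotents_star
    exact ⟨fun i => t i.rev, ht.comp Fin.rev_injective, fun i => hev _, fun i => h1 _,
      fun i j hij => h0 _ _ fun h => hij (Fin.rev_injective h)⟩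
  tridiagonal := by
    have habs : ∀ i j : Fin (d + 1),
        |((i.rev : Fin (d + 1)) : ℤ) - (j.rev : Fin (d + 1))| = |(i : ℤ) - j| := by
      intro i j
      rw [← abs_neg ((i : ℤ) - j)]
      congr 1
      simp only [Fin.val_rev]
      omega
    exact ⟨fun i j hij => hL.tridiagonal.1 _ _ (by rwa [habs]),
      fun i j hij => hL.tridiagonal.2 _ _ (by rwa [habs])⟩
  tridiagonal_star := hL.tridiagonal_star

/-- In a bipartite Leonard system `θ i` is proportional to `θs i - θs (d - i)`. -/
theorem IsLeonardSystem.exists_proportional {A As : End F V} {E Es : Fin (d + 1) → End F V}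
    (hL : IsLeonardSystem A E As Es) (hbip : IsBipartite A Es) {θ θs : Fin (d + 1) → F}
    (hθ : ∀ i, IsEigenvalueOf A (LinearMap.range (E i)) (θ i))
    (hθs : ∀ i, IsEigenvalueOf As (LinearMap.range (Es i)) (θs i)) (hd : 0 < d) :
    ∃ c : F, c ≠ 0 ∧ ∀ i : Fin (d + 1), θs i.rev - θs i = c * θ i := by
  have hinjs := (exists_eigenbasis hL.finrank_eq hL.idempotents_star hθs).1
  -- φ ≠ 0 makes the partial sum nonzero; subtracting the reversed system's identities cancels the
  -- dual traces.
  have hrel : ∀ i : Fin d, ∑ h ∈ Finset.Iic i.castSucc, θ h ≠ 0 ∧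
      (∑ h ∈ Finset.Iic i.castSucc, (θs h.rev - θs h)) * (θ i.castSucc - θ i.succ) =
      (∑ h ∈ Finset.Iic i.castSucc, θ h) *
        ((θs i.castSucc.rev - θs i.castSucc) - (θs i.succ.rev - θs i.succ)) := by
    intro i
    obtain ⟨φ, hφ, h1, h2⟩ := hL.exists_split_entry hθ hθs i
    obtain ⟨ψ, -, h3, h4⟩ := hL.rev_star.exists_split_entry hθ (fun i => hθs i.rev) i
    have hb : ∀ h, LinearMap.trace F V (Es h * A) = 0 := hbip
    simp only [hb, Finset.sum_const_zero, zero_sub] at h1 h3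
    refine ⟨fun h0 => hφ ?_, ?_⟩
    · rw [← h1, h0, neg_zero, zero_mul]
    · rw [Finset.sum_sub_distrib]
      linear_combination h2 - h4 - h1 + h3
  have h00 : θ 0 ≠ 0 := by
    have h := (hrel ⟨0, hd⟩).1
    have h0 : Finset.Iic (Fin.castSucc (⟨0, hd⟩ : Fin d)) = {0} := by
      ext a
      rw [Finset.mem_Iic, Finset.mem_singleton]
      exact Fin.le_zero_iff
    rwa [h0, Finset.sum_singleton] at h
  have hg0 : θs (Fin.rev 0) - θs 0 ≠ 0 := by
    refine sub_ne_zero.2 fun h => ?_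
    have := congrArg Fin.val (hinjs h)
    simp at this
    omega
  refine ⟨(θs (Fin.rev 0) - θs 0) / θ 0, div_ne_zero hg0 h00, ?_⟩
  set c := (θs (Fin.rev 0) - θs 0) / θ 0 with hc
  have hmain : ∀ n, ∀ i : Fin (d + 1), i.val ≤ n → θs i.rev - θs i = c * θ i := by
    intro n
    induction n with
    | zero =>
      intro i hi
      obtain rfl : i = 0 := Fin.ext (by simpa using hi)
      rw [hc, div_mul_cancel₀ _ h00]
    | succ n ih =>
      intro i hi
      rcases Nat.lt_or_ge i.val (n + 1) with h | h
      · exact ih i (by omega)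
      · obtain ⟨k, rfl⟩ : ∃ k : Fin d, i = k.succ :=
          ⟨⟨n, by omega⟩, Fin.ext (by simp; omega)⟩
        have hk : k.val = n := by simp at hi h; omega
        obtain ⟨hS, hr⟩ := hrel k
        rw [Finset.sum_congr rfl fun a ha => ih a ?_, ← Finset.mul_sum,
          ih k.castSucc (by simp [hk])] at hr
        · refine mul_left_cancel₀ hS ?_
          linear_combination hr
        · have : a ≤ k.castSucc := Finset.mem_Iic.1 ha
          rw [Fin.le_def, Fin.val_castSucc] at this
          omega
  exact fun i => hmain i i le_rfl

end System

/-! ### Soundness and completeness of the recursion. -/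

section Recursion

variable {F V : Type*} [Field F] [AddCommGroup V] [Module F V]

/-- Here E*_0 = 1, so bipartiteness says tr A = 0. This makes (ii) vacuous for d = 0. -/
theorem eigenvalue_eq_zero_of_diameter_zero {A As : End F V} {E Es : Fin (0 + 1) → End F V}
    (hL : IsLeonardSystem A E As Es) (hbip : IsBipartite A Es) {θ θs : Fin (0 + 1) → F}
    (hθ : ∀ i, IsEigenvalueOf A (LinearMap.range (E i)) (θ i))
    (hθs : ∀ i, IsEigenvalueOf As (LinearMap.range (Es i)) (θs i)) (j : Fin (0 + 1)) :
    θ j = 0 := by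
  have : Subsingleton (Fin (0 + 1)) := inferInstanceAs (Subsingleton (Fin 1))
  obtain ⟨-, v, hAv, -⟩ := exists_eigenbasis hL.finrank_eq hL.idempotents hθ
  obtain ⟨-, w, -, hEw⟩ := exists_eigenbasis hL.finrank_eq hL.idempotents_star hθs
  have h1 : Es j = 1 := LinearMap.ext fun x => by
    rw [hEw, Module.End.one_apply]
    conv_rhs => rw [← w.sum_repr x]
    rw [Fintype.sum_subsingleton _ j]
  have h := hbip j
  rw [h1, one_mul, LinearMap.trace_eq_matrix_trace F v, Matrix.trace,
    Fintype.sum_subsingleton _ j, Matrix.diag_apply, LinearMap.toMatrix_apply, hAv] at h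
  simpa using h

variable {d : ℕ}

theorem RecComputes.eq_of_proportional {θ θs : Fin (d + 1) → F} {c : F} (hc : c ≠ 0)
    (hg : ∀ i : Fin (d + 1), θs i.rev - θs i = c * θ i) {j i : Fin (d + 1)} {y : F}
    (h : RecComputes θs j (θ j) i y) : y = θ i := by
  induction h with
  | start => rfl
  | reflect i y _ ih =>
    subst ih
    have h := hg i.rev
    rw [Fin.rev_rev] at h
    refine mul_left_cancel₀ hc ?_
    linear_combination h + hg i
  | up i y _ hne ih =>
    subst ih
    rw [div_eq_iff hne, hg, hg]
    ring
  | down i y _ hne ih =>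
    subst ih
    rw [div_eq_iff hne, hg, hg]
    ring

/-- Reflect into the lower half if needed, descend to 0, climb to the middle, and reflect to reach
the upper half. No division occurs at 2i = d. -/
theorem recComputes_of_proportional {θ θs : Fin (d + 1) → F} {c : F} (hc : c ≠ 0)
    (hinj : Function.Injective θ) (hg : ∀ i : Fin (d + 1), θs i.rev - θs i = c * θ i)
    {j : Fin (d + 1)} (hj : θ j ≠ 0) (i : Fin (d + 1)) : RecComputes θs j (θ j) i (θ i) := by
  have correct : ∀ {i y}, RecComputes θs j (θ j) i y → RecComputes θs j (θ j) i (θ i) :=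
    fun h => h.eq_of_proportional hc hg ▸ h
  have hrev : ∀ i : Fin (d + 1), θ i.rev = -θ i := by
    intro i
    have h := hg i.rev
    rw [Fin.rev_rev] at h
    refine mul_left_cancel₀ hc ?_
    linear_combination -h - hg i
  have hne : ∀ i : Fin (d + 1), 2 * i.val ≠ d → θs i.rev - θs i ≠ 0 := by
    intro i hi h0
    rw [hg, mul_eq_zero, or_iff_right hc] at h0
    have h := hinj ((hrev i).trans (by rw [h0, neg_zero] : -θ i = θ i))
    have := congrArg Fin.val h
    rw [Fin.val_rev] at this
    omega
  -- At a middle index θ*_{d-j} - θ*_j = 0, forcing θ_j = 0.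
  have hj2 : 2 * j.val ≠ d := by
    intro h
    have hjr : j.rev = j := Fin.ext (by rw [Fin.val_rev]; omega)
    have h' := hg j
    rw [hjr, sub_self, eq_comm, mul_eq_zero, or_iff_right hc] at h'
    exact hj h'
  have down : ∀ n (hn : n < d + 1), 2 * n < d → RecComputes θs j (θ j) ⟨n, hn⟩ (θ ⟨n, hn⟩) →
      RecComputes θs j (θ j) 0 (θ 0) := by
    intro n
    induction n with
    | zero => exact fun _ _ h => h
    | succ n ih =>
      intro hn h2 h
      exact ih (by omega) (by omega)
        (correct (RecComputes.down ⟨n, by omega⟩ _ h (hne ⟨n + 1, hn⟩ h2.ne)))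
  have hzero : RecComputes θs j (θ j) 0 (θ 0) := by
    rcases lt_or_gt_of_ne hj2 with h | h
    · exact down j j.2 h .start
    · exact down j.rev j.rev.2 (by rw [Fin.val_rev]; omega) (correct (RecComputes.start.reflect))
  have up : ∀ n (hn : n < d + 1), 2 * n ≤ d → RecComputes θs j (θ j) ⟨n, hn⟩ (θ ⟨n, hn⟩) := by
    intro n
    induction n with
    | zero => exact fun _ _ => hzero
    | succ n ih =>
      intro hn h2
      exact correct (RecComputes.up ⟨n, by omega⟩ _ (ih (by omega) (by omega))
        (hne ⟨n, by omega⟩ (by simp only []; omega)))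
  rcases le_or_gt (2 * i.val) d with h | h
  · exact up i i.2 h
  · have := (up i.rev i.rev.2 (by rw [Fin.val_rev]; omega)).reflect
    rw [Fin.eta, Fin.rev_rev] at this
    exact correct this

end Recursion

end Leonard

/-- For `i : Fin d`, the indices `i.castSucc`, `i.succ`, `i.castSucc.rev`, `i.succ.rev` of
`Fin (d + 1)` are `i`, `i + 1`, `d - i`, `d - i - 1`. -/
theorem proposition9p4 {F V : Type*} [Field F] [AddCommGroup V] [Module F V] {d : ℕ}
    (A As : Module.End F V) (E Es : Fin (d + 1) → Module.End F V)
    (hL : Leonard.IsLeonardSystem A E As Es) (hbip : Leonard.IsBipartite A Es)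
    (θ θs : Fin (d + 1) → F)
    (hθ : ∀ i, Leonard.IsEigenvalueOf A (LinearMap.range (E i)) (θ i))
    (hθs : ∀ i, Leonard.IsEigenvalueOf As (LinearMap.range (Es i)) (θs i)) :
    (∀ i : Fin d, θ i.castSucc * (θs i.succ.rev - θs i.succ) =
      θ i.succ * (θs i.castSucc.rev - θs i.castSucc)) ∧
    (∀ j : Fin (d + 1), θ j ≠ 0 → ∀ (i : Fin (d + 1)) (y : F),
      Leonard.RecComputes θs j (θ j) i y ↔ y = θ i) := by
  rcases Nat.eq_zero_or_pos d with rfl | hd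
  · exact ⟨fun i => i.elim0, fun j hj =>
      absurd (Leonard.eigenvalue_eq_zero_of_diameter_zero hL hbip hθ hθs j) hj⟩
  · obtain ⟨c, hc, hg⟩ := hL.exists_proportional hbip hθ hθs hd
    have hinj := (Leonard.exists_eigenbasis hL.finrank_eq hL.idempotents hθ).1
    refine ⟨fun i => by rw [hg, hg]; ring, fun j hj i y => ⟨fun h => h.eq_of_proportional hc hg, ?_⟩⟩
    rintro rfl
    exact Leonard.recComputes_of_proportional hc hinj hg hj i
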